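/- Let $N\ge 2$, $T>0$, $\epsilon>0$, $\alpha\in(0,1)$ and $f:\{1,\dots,N\}\to(0,\infty)$, with $f_{\max}=\max_n f(n)$, $f_{\min}=\min_n f(n)$ and $\bar f=\frac1N\sum_{n=1}^N f(n)$. Assume that $$\min\Big\{\tfrac12\Big[N+1-\max_{1\le k\le N}\sqrt{\sum_{n\ne k}f(n)\sum_{n\neq k}\tfrac1{f(n)}}\Big],\,1\Big\}>\frac1{f_{\min}}\sqrt{\sum_{n=1}^N(f(n)-\bar f)^2}+\frac{f_{\max}-f_{\min}}{f_{\min}}.$$ Let $\sigma:[0,\infty)\times\mathbb R\to\mathbb R$ be smooth with all derivatives bounded and $\sigma_0\le\sigma\le\sigma_1$ for some constants $0<\sigma_0<\sigma_1$. Let $P_1,\dots,P_N:\mathbb R\to[0,\infty)$ be integrable functions with $\int P_n\,dx=m_n$ and $\sum_{n=1}^N m_n=1$ (that is, $P_n(x)\,dx=\mathbb P(X_0\in dx,\,Y=n)$ and $m_n=\mathbb P(Y=n)$ for some pair $(X_0,Y)$ of random variables), such that each $P_n$ belongs to $C^{2+\alpha}(\mathbb R)$: $P_n$ is twice continuously differentiable,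 and $P_n,P_n',P_n''$ are bounded and $\alpha$-Hölder. For $\beta\in(0,1)$ let $C^{1+\beta/2,2+\beta}$ be the space of functions $\phi$ on $[0,T]\times\mathbb R$ for which $\phi,\partial_x\phi,\partial_{xx}\phi,\partial_t\phi$ exist (with one-sided time derivatives at $t=0$ and $t=T$), are continuous and bounded, and such that, on $[0,T]\times\mathbb R$, $\partial_x\phi$ is $\frac{1+\beta}2$-Hölder in $t$ uniformly in $x$, and $\partial_{xx}\phi$ and $\partial_t\phi$ are $\frac\beta2$-Hölder in $t$ uniformly in $x$ and $\beta$-Hölder in $x$ uniformly in $t$. Then there is at most one $p=(p_1,\dots,p_N)\in\big(C^{1+\alpha/4,2+\alpha/2}\big)^N$ such that, for all $1\le n\le N$, $$\partial_t p_n=\tfrac12\partial_{xx}\big[\sigma^2B_n^\epsilon(p)p_n\big]+\tfrac12\partial_x\big[\sigma^2B_n^\epsilon(p)p_n\big]\ \text{ on }[0,T]\times\mathbb R,\qquad B^\epsilon_n(u)=\frac{\epsilon+f(n)\sum_{k=1}^N u_k}{\epsilon+\sum_{k=1}^N f(k)u_k},$$ $p_n(0,\cdot)=P_n$, and, for every $t\in[0,T]$,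 $p_n(t,\cdot)\ge0$ is integrable with $\int p_n(t,x)\,dx=m_n$ (for $m_n>0$: $p_n(t,\cdot)/m_n$ is a probability density). -/

import Mathlib

open scoped ContDiff

noncomputable section

namespace LSV

/-- The time derivative on `[0,T]` (one-sided at the end points). -/
def dt (T : ℝ) (φ : ℝ → ℝ → ℝ) (t x : ℝ) : ℝ :=
  derivWithin (fun s => φ s x) (Set.Icc 0 T) t

/-- The space derivative. -/
def dx (φ : ℝ → ℝ → ℝ) (t x : ℝ) : ℝ :=
  deriv (φ t) x

/-- `φ` is bounded on `[0,T] × ℝ`. -/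
def BoundedStrip (T : ℝ) (φ : ℝ → ℝ → ℝ) : Prop :=
  ∃ C : ℝ, ∀ t ∈ Set.Icc 0 T, ∀ x : ℝ, |φ t x| ≤ C

/-- `φ` is continuous on `[0,T] × ℝ`. -/
def ContStrip (T : ℝ) (φ : ℝ → ℝ → ℝ) : Prop :=
  ContinuousOn (fun z : ℝ × ℝ => φ z.1 z.2) (Set.Icc 0 T ×ˢ Set.univ)

/-- `φ` is `γ`-Hölder in time on `[0,T]`, uniformly in space. -/
def TimeHolder (T γ : ℝ) (φ : ℝ → ℝ → ℝ) : Prop :=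
  ∃ C : ℝ, ∀ t ∈ Set.Icc 0 T, ∀ s ∈ Set.Icc 0 T, ∀ x : ℝ,
    |φ t x - φ s x| ≤ C * |t - s| ^ γ

/-- `φ` is `γ`-Hölder in space, uniformly in time on `[0,T]`. -/
def SpaceHolder (T γ : ℝ) (φ : ℝ → ℝ → ℝ) : Prop :=
  ∃ C : ℝ, ∀ t ∈ Set.Icc 0 T, ∀ x y : ℝ, |φ t x - φ t y| ≤ C * |x - y| ^ γ

/-- The parabolic Hölder space `C^{(2+β)/2, 2+β}` of functions on `[0,T] × ℝ`: the derivatives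
`∂_t^r ∂_x^l φ` with `2r + l ≤ 2` exist, are continuous and bounded, and satisfy the
Hölder bounds that make the parabolic Hölder norm finite. Values of `φ` at times outside
`[0,T]` play no role. -/
structure ParabolicHolder (T β : ℝ) (φ : ℝ → ℝ → ℝ) : Prop where
  diff_t : ∀ t ∈ Set.Icc 0 T, ∀ x : ℝ,
    DifferentiableWithinAt ℝ (fun s => φ s x) (Set.Icc 0 T) t
  diff_x : ∀ t ∈ Set.Icc 0 T, Differentiable ℝ (φ t)
  diff_xx : ∀ t ∈ Set.Icc 0 T, Differentiable ℝ (dx φ t)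
  cont : ContStrip T φ
  cont_x : ContStrip T (dx φ)
  cont_xx : ContStrip T (dx (dx φ))
  cont_t : ContStrip T (dt T φ)
  bdd : BoundedStrip T φ
  bdd_x : BoundedStrip T (dx φ)
  bdd_xx : BoundedStrip T (dx (dx φ))
  bdd_t : BoundedStrip T (dt T φ)
  timeHolder_x : TimeHolder T ((1 + β) / 2) (dx φ)
  timeHolder_xx : TimeHolder T (β / 2) (dx (dx φ))
  timeHolder_t : TimeHolder T (β / 2) (dt T φ)
  spaceHolder_xx : SpaceHolder T β (dx (dx φ))
  spaceHolder_t : SpaceHolder T β (dt T φ)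

/-- The Hölder space `C^{2+α}` on the real line. -/
def HolderTwo (α : ℝ) (φ : ℝ → ℝ) : Prop :=
  ContDiff ℝ 2 φ ∧ ∀ k ≤ 2,
    (∃ C : ℝ, ∀ x, |iteratedDeriv k φ x| ≤ C) ∧
    ∃ C : ℝ, ∀ x y, |iteratedDeriv k φ x - iteratedDeriv k φ y| ≤ C * |x - y| ^ α

/-- `σ` is smooth on `[0,∞) × ℝ`, all its derivatives are bounded there, and it takes values
between two positive constants. -/
structure VolatilityAssumption (σ : ℝ → ℝ → ℝ) : Prop where
  smooth : ContDiffOn ℝ ∞ (Function.uncurry σ) (Set.Ici 0 ×ˢ Set.univ)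
  bdd_deriv : ∀ k : ℕ, 1 ≤ k → ∃ C : ℝ, ∀ z ∈ (Set.Ici 0 ×ˢ Set.univ : Set (ℝ × ℝ)),
    ‖iteratedFDerivWithin ℝ k (Function.uncurry σ) (Set.Ici 0 ×ˢ Set.univ) z‖ ≤ C
  bounds : ∃ σ₀ σ₁ : ℝ, 0 < σ₀ ∧ σ₀ < σ₁ ∧ ∀ t, 0 ≤ t → ∀ x, σ₀ ≤ σ t x ∧ σ t x ≤ σ₁

variable {N : ℕ}

/-- The arithmetic mean of the values of `f`. -/
def fbar (f : Fin N → ℝ) : ℝ := (∑ n, f n) / N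

/-- The largest value of `f`. -/
def fmax (f : Fin N → ℝ) : ℝ := ⨆ n, f n

/-- The smallest value of `f`. -/
def fmin (f : Fin N → ℝ) : ℝ := ⨅ n, f n

/-- The small range condition on `f`. -/
def SmallRange (f : Fin N → ℝ) : Prop :=
  min (1 / 2 * ((N : ℝ) + 1 -
      ⨆ k : Fin N, √((∑ n ∈ Finset.univ.erase k, f n) * ∑ n ∈ Finset.univ.erase k, 1 / f n))) 1
    > 1 / fmin f * √(∑ n, (f n - fbar f) ^ 2) + (fmax f - fmin f) / fmin f

/-- The diagonal coefficient `B^ε_n(u) = (ε + f(n) ∑ u_k) / (ε + ∑ f(k) u_k)`. -/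
def B (ε : ℝ) (f : Fin N → ℝ) (u : Fin N → ℝ) (n : Fin N) : ℝ :=
  (ε + f n * ∑ k, u k) / (ε + ∑ k, f k * u k)

/-- The function `σ² B^ε_n(p) p_n`. -/
def flux (ε : ℝ) (f : Fin N → ℝ) (σ : ℝ → ℝ → ℝ) (p : Fin N → ℝ → ℝ → ℝ) (n : Fin N)
    (t x : ℝ) : ℝ :=
  σ t x ^ 2 * B ε f (fun k => p k t x) n * p n t x

/-- `P_n` are the densities of a probability law on `ℝ × {1,…,N}` (that of `(X₀, Y)`) whose second
marginal (the law of `Y`) gives mass `m n` to `n`. -/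
structure InitialDensities (m : Fin N → ℝ) (P : Fin N → ℝ → ℝ) : Prop where
  nonneg : ∀ n x, 0 ≤ P n x
  integrable : ∀ n, MeasureTheory.Integrable (P n)
  mass : ∀ n, ∫ x, P n x = m n
  total : ∑ n, m n = 1

/-- `p` solves, in the classical sense on `[0,T] × ℝ`, the system
`∂_t p = ½ ∂_xx[σ² B^ε(p) p] + ½ ∂_x[σ² B^ε(p) p]` with initial value `P`, and `p_n(t,·) / m_n` is
a probability density for every `t`: the last requirement is written multiplied by `m_n`, so that
it also makes sense for `m_n = 0`. -/
structure IsSolution (T ε : ℝ) (f : Fin N → ℝ) (σ : ℝ → ℝ → ℝ) (m : Fin N → ℝ)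
    (P : Fin N → ℝ → ℝ) (p : Fin N → ℝ → ℝ → ℝ) : Prop where
  pde : ∀ n, ∀ t ∈ Set.Icc 0 T, ∀ x : ℝ,
    dt T (p n) t x = 1 / 2 * dx (dx (flux ε f σ p n)) t x + 1 / 2 * dx (flux ε f σ p n) t x
  nonneg : ∀ n, ∀ t ∈ Set.Icc 0 T, ∀ x : ℝ, 0 ≤ p n t x
  integrable : ∀ n, ∀ t ∈ Set.Icc 0 T, MeasureTheory.Integrable (p n t)
  mass : ∀ n, ∀ t ∈ Set.Icc 0 T, ∫ x, p n t x = m n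
  init : ∀ n x, p n 0 x = P n x

end LSV

end

namespace LSV

open MeasureTheory

/-! Let `w` be the difference of two solutions. In divergence form, `∂_t w_n = ½ ∂_x G_n`, where
`G_n` is the difference of the currents `∂_x(flux) + flux`. If `∑ G_n ∂_x w_n` bounds `|∂_x w|²`
from below, up to a cross term `|w| |∂_x w|`, then the energy `∫ (1 + x²)⁻¹ |w|²` satisfies a
Gronwall inequality and vanishes (`eq_zero_of_coercive`). The weight makes all integrals converge
using boundedness alone, and its logarithmic derivative is bounded.

The Jacobian of `u ↦ (B_n(u) u_n)` need not be coercive on all vectors. But `∑ B_n(u) u_n = ∑ u_n`,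
so `∑ w_n` solves a scalar linear equation and is zero by a first use of the energy method. Hence
`∂_x w` has zero sum, and coercivity is needed only on zero-sum vectors, where the small range
condition supplies it (`sum_mul_nonlinDeriv_ge`). A second use of the energy method, with
`exists_lipschitz_nonlin` for the lower order terms, gives `w = 0`. -/

/-! ### Weighted energy method -/

/-- A product of the weight `(1 + x²)⁻¹` and a bounded continuous function is integrable. -/
theorem integrable_weight_mul {g : ℝ → ℝ} (hg : Continuous g) {C : ℝ} (hC : ∀ x, |g x| ≤ C) :
    Integrable (fun x : ℝ => (1 + x ^ 2)⁻¹ * g x) :=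
  integrable_inv_one_add_sq.mul_bdd hg.aestronglyMeasurable (Filter.Eventually.of_forall hC)

theorem hasDerivAt_weight (x : ℝ) :
    HasDerivAt (fun y : ℝ => (1 + y ^ 2)⁻¹) ((1 + x ^ 2)⁻¹ * (-(2 * x) / (1 + x ^ 2))) x := by
  have h : HasDerivAt (fun y : ℝ => 1 + y ^ 2) (2 * x) x := by
    simpa using (hasDerivAt_pow 2 x).const_add 1
  have h0 : (1 + x ^ 2) ≠ 0 := by positivity
  refine (h.inv h0).congr_deriv ?_
  field_simp

theorem abs_weight_logDeriv_le (x : ℝ) : |-(2 * x) / (1 + x ^ 2)| ≤ 1 := by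
  have h0 : 0 < 1 + x ^ 2 := by positivity
  rw [abs_div, abs_of_pos h0, div_le_one h0, abs_le]
  constructor <;> nlinarith [sq_nonneg (x - 1), sq_nonneg (x + 1)]

/-- Young's inequality for the integrand of the weighted energy identity. -/
theorem exists_neg_sum_le {ι : Type*} [Fintype ι] [Nonempty ι] {c C : ℝ} (hc : 0 < c)
    (hC : 0 ≤ C) :
    ∃ K : ℝ, ∀ (w ξ G : ι → ℝ) (k : ℝ), |k| ≤ 1 →
      (∀ n, |G n| ≤ C * (∑ i, |w i| + ∑ i, |ξ i|)) →
      c * ∑ i, ξ i ^ 2 - C * (∑ i, |w i|) * ∑ i, |ξ i| ≤ ∑ i, ξ i * G i →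
      -∑ i, (ξ i + k * w i) * G i ≤ K * ∑ i, w i ^ 2 := by
  set N : ℝ := (Fintype.card ι : ℝ) with hN
  have hNpos : 0 < N := by rw [hN]; exact_mod_cast Fintype.card_pos
  -- With `a = ∑ |w_i|` and `b = ∑ |ξ_i|`, the cross terms add up to `2 C a b`, half from coercivity
  -- and half from `k w G`. Completing the square against `c b² / N` costs `C² N a² / c`; the outer
  -- `N` comes from `a² ≤ N ∑ w_i²`.
  refine ⟨(C ^ 2 * N / c + C) * N, fun w ξ G k hk hG hcoer => ?_⟩
  set a := ∑ i, |w i| with ha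
  set b := ∑ i, |ξ i| with hb
  have ha0 : 0 ≤ a := Finset.sum_nonneg fun _ _ => abs_nonneg _
  have hb0 : 0 ≤ b := Finset.sum_nonneg fun _ _ => abs_nonneg _
  have ha2 : a ^ 2 ≤ N * ∑ i, w i ^ 2 := by
    simpa [sq_abs] using sq_sum_le_card_mul_sum_sq (s := Finset.univ) (f := fun i => |w i|)
  have hb2 : b ^ 2 ≤ N * ∑ i, ξ i ^ 2 := by
    simpa [sq_abs] using sq_sum_le_card_mul_sum_sq (s := Finset.univ) (f := fun i => |ξ i|)
  have hkG : |∑ i, k * w i * G i| ≤ a * (C * (a + b)) := by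
    refine (Finset.abs_sum_le_sum_abs _ _).trans ?_
    rw [ha, Finset.sum_mul]
    refine Finset.sum_le_sum fun i _ => ?_
    rw [abs_mul, abs_mul]
    refine mul_le_mul ?_ (hG i) (abs_nonneg _) (abs_nonneg _)
    nlinarith [abs_nonneg (w i)]
  have hsplit : ∑ i, (ξ i + k * w i) * G i = ∑ i, ξ i * G i + ∑ i, k * w i * G i := by
    rw [← Finset.sum_add_distrib]
    exact Finset.sum_congr rfl fun _ _ => by ring
  have h1 : -∑ i, (ξ i + k * w i) * G i ≤ -(c * (b ^ 2 / N)) + 2 * C * a * b + C * a ^ 2 := by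
    have : b ^ 2 / N ≤ ∑ i, ξ i ^ 2 := by rw [div_le_iff₀ hNpos]; linarith
    have := mul_le_mul_of_nonneg_left this hc.le
    have := neg_abs_le (∑ i, k * w i * G i)
    rw [hsplit]
    nlinarith
  have h2 : -(c * (b ^ 2 / N)) + 2 * C * a * b ≤ C ^ 2 * N / c * a ^ 2 := by
    have : 0 ≤ (c * b - C * N * a) ^ 2 / (c * N) := by positivity
    have e : (c * b - C * N * a) ^ 2 / (c * N)
        = c * (b ^ 2 / N) - 2 * C * a * b + C ^ 2 * N / c * a ^ 2 := by
      field_simp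
      ring
    linarith
  have h3 : (C ^ 2 * N / c + C) * a ^ 2 ≤ (C ^ 2 * N / c + C) * (N * ∑ i, w i ^ 2) :=
    mul_le_mul_of_nonneg_left ha2 (by positivity)
  linarith

/-- Uniqueness by the weighted energy method: a bounded solution of `∂_t w = ½ ∂_x G`
vanishing at time zero, with `G` coercive in `∂_x w` up to terms controlled by `w`, is zero. -/
theorem eq_zero_of_coercive {ι : Type*} [Fintype ι] [Nonempty ι] {T c C M : ℝ}
    (hT : 0 < T) (hc : 0 < c) (hC : 0 ≤ C) {w wt wx G : ι → ℝ → ℝ → ℝ}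
    (hw0 : ∀ n x, w n 0 x = 0)
    (hwct : ∀ n x, ContinuousOn (fun s => w n s x) (Set.Icc 0 T))
    (hwt : ∀ n, ∀ t ∈ Set.Ioo 0 T, ∀ x, HasDerivAt (fun s => w n s x) (wt n t x) t)
    (hwx : ∀ n, ∀ t ∈ Set.Icc 0 T, ∀ x, HasDerivAt (w n t) (wx n t x) x)
    (hwtc : ∀ n, ∀ t ∈ Set.Icc 0 T, Continuous (wt n t))
    (hwxc : ∀ n, ∀ t ∈ Set.Icc 0 T, Continuous (wx n t))
    (hwM : ∀ n, ∀ t ∈ Set.Icc 0 T, ∀ x, |w n t x| ≤ M)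
    (hwtM : ∀ n, ∀ t ∈ Set.Icc 0 T, ∀ x, |wt n t x| ≤ M)
    (hwxM : ∀ n, ∀ t ∈ Set.Icc 0 T, ∀ x, |wx n t x| ≤ M)
    (hG : ∀ n, ∀ t ∈ Set.Icc 0 T, ∀ x, HasDerivAt (G n t) (2 * wt n t x) x)
    (hGle : ∀ n, ∀ t ∈ Set.Icc 0 T, ∀ x,
      |G n t x| ≤ C * (∑ i, |w i t x| + ∑ i, |wx i t x|))
    (hcoer : ∀ t ∈ Set.Icc 0 T, ∀ x,
      c * ∑ i, wx i t x ^ 2 - C * (∑ i, |w i t x|) * ∑ i, |wx i t x|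
        ≤ ∑ i, wx i t x * G i t x) :
    ∀ n, ∀ t ∈ Set.Icc 0 T, ∀ x, w n t x = 0 := by
  obtain ⟨K, hK⟩ := exists_neg_sum_le (ι := ι) hc hC
  have h0T : (0 : ℝ) ∈ Set.Icc 0 T := ⟨le_rfl, hT.le⟩
  have hwc : ∀ n, ∀ t ∈ Set.Icc 0 T, Continuous (w n t) := fun n t ht =>
    continuous_iff_continuousAt.2 fun x => (hwx n t ht x).continuousAt
  have hGc : ∀ n, ∀ t ∈ Set.Icc 0 T, Continuous (G n t) := fun n t ht =>
    continuous_iff_continuousAt.2 fun x => (hG n t ht x).continuousAt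
  set L : ℝ := C * (∑ _i : ι, M + ∑ _i : ι, M) with hL
  have hGM : ∀ n, ∀ t ∈ Set.Icc 0 T, ∀ x, |G n t x| ≤ L := fun n t ht x =>
    (hGle n t ht x).trans <| mul_le_mul_of_nonneg_left
      (add_le_add (Finset.sum_le_sum fun i _ => hwM i t ht x)
        (Finset.sum_le_sum fun i _ => hwxM i t ht x)) hC
  have abs_mul_le : ∀ {a b A B : ℝ}, |a| ≤ A → |b| ≤ B → |a * b| ≤ A * B := fun ha hb => by
    rw [abs_mul]
    exact mul_le_mul ha hb (abs_nonneg _) ((abs_nonneg _).trans ha)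
  have abs_sum_le : ∀ {g : ι → ℝ} {A : ℝ}, (∀ i, |g i| ≤ A) → |∑ i, g i| ≤ ∑ _i : ι, A :=
    fun h => (Finset.abs_sum_le_sum_abs _ _).trans (Finset.sum_le_sum fun i _ => h i)
  -- the energy and its integrand
  set e : ℝ → ℝ → ℝ := fun t x => ∑ n, w n t x ^ 2 with he
  set e' : ℝ → ℝ → ℝ := fun t x => ∑ n, w n t x * (2 * wt n t x) with he'
  set E : ℝ → ℝ := fun t => ∫ x, (1 + x ^ 2)⁻¹ * e t x with hE
  have hec : ∀ t ∈ Set.Icc 0 T, Continuous (e t) := fun t ht =>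
    continuous_finsetSum _ fun n _ => (hwc n t ht).pow 2
  have hec' : ∀ t ∈ Set.Icc 0 T, Continuous (e' t) := fun t ht =>
    continuous_finsetSum _ fun n _ => (hwc n t ht).mul (continuous_const.mul (hwtc n t ht))
  have heM : ∀ t ∈ Set.Icc 0 T, ∀ x, |e t x| ≤ ∑ _i : ι, M * M := fun t ht x =>
    abs_sum_le fun i => by rw [sq]; exact abs_mul_le (hwM i t ht x) (hwM i t ht x)
  have heM' : ∀ t ∈ Set.Icc 0 T, ∀ x, |e' t x| ≤ ∑ _i : ι, M * (2 * M) := fun t ht x =>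
    abs_sum_le fun i => abs_mul_le (hwM i t ht x)
      (abs_mul_le (le_of_eq (abs_of_pos two_pos)) (hwtM i t ht x))
  have hint : ∀ t ∈ Set.Icc 0 T, Integrable (fun x : ℝ => (1 + x ^ 2)⁻¹ * e t x) := fun t ht =>
    integrable_weight_mul (hec t ht) (heM t ht)
  have hint' : ∀ t ∈ Set.Icc 0 T, Integrable (fun x : ℝ => (1 + x ^ 2)⁻¹ * e' t x) :=
    fun t ht => integrable_weight_mul (hec' t ht) (heM' t ht)
  have hwpos : ∀ x : ℝ, 0 < (1 + x ^ 2)⁻¹ := fun x => by positivity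
  have hbound : ∀ {g A : ℝ} (x : ℝ), |g| ≤ A → ‖(1 + x ^ 2)⁻¹ * g‖ ≤ (1 + x ^ 2)⁻¹ * A := by
    intro g A x h
    rw [Real.norm_eq_abs, abs_mul, abs_of_pos (hwpos x)]
    exact mul_le_mul_of_nonneg_left h (hwpos x).le
  have hEc : ContinuousOn E (Set.Icc 0 T) := by
    refine continuousOn_of_dominated
      (bound := fun x => (1 + x ^ 2)⁻¹ * ∑ _i : ι, M * M)
      (fun t ht => (hint t ht).aestronglyMeasurable)
      (fun t ht => Filter.Eventually.of_forall fun x => hbound x (heM t ht x))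
      (integrable_inv_one_add_sq.mul_const _) (Filter.Eventually.of_forall fun x => ?_)
    exact continuousOn_const.mul (continuousOn_finsetSum _ fun n _ => (hwct n x).pow 2)
  have hEd : ∀ t ∈ Set.Ioo 0 T, HasDerivAt E (∫ x, (1 + x ^ 2)⁻¹ * e' t x) t := by
    intro t ht
    have hsub : Set.Ioo 0 T ⊆ Set.Icc 0 T := Set.Ioo_subset_Icc_self
    refine (hasDerivAt_integral_of_dominated_loc_of_deriv_le
      (s := Set.Ioo 0 T) (bound := fun x => (1 + x ^ 2)⁻¹ * ∑ _i : ι, M * (2 * M))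
      (F := fun t x => (1 + x ^ 2)⁻¹ * e t x) (F' := fun t x => (1 + x ^ 2)⁻¹ * e' t x)
      (Ioo_mem_nhds ht.1 ht.2) ?_ (hint t (hsub ht)) (hint' t (hsub ht)).aestronglyMeasurable
      (Filter.Eventually.of_forall fun x s hs => hbound x (heM' s (hsub hs) x))
      (integrable_inv_one_add_sq.mul_const _) (Filter.Eventually.of_forall fun x s hs => ?_)).2
    · filter_upwards [Ioo_mem_nhds ht.1 ht.2] with s hs
      exact (hint s (hsub hs)).aestronglyMeasurable
    · refine HasDerivAt.const_mul _ ?_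
      refine (HasDerivAt.fun_sum fun n _ => (hwt n s hs x).pow 2).congr_deriv ?_
      exact Finset.sum_congr rfl fun n _ => by push_cast; ring
  have hEd_le : ∀ t ∈ Set.Icc 0 T, ∫ x, (1 + x ^ 2)⁻¹ * e' t x ≤ K * E t := by
    intro t ht
    set r : ℝ → ℝ := fun x => ∑ n, (wx n t x + -(2 * x) / (1 + x ^ 2) * w n t x) * G n t x
      with hr
    have hkc : Continuous fun x : ℝ => -(2 * x) / (1 + x ^ 2) :=
      (by fun_prop : Continuous fun x : ℝ => -(2 * x)).div (by fun_prop)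
        fun x => by positivity
    have hrc : Continuous r := continuous_finsetSum _ fun n _ =>
      ((hwxc n t ht).add (hkc.mul (hwc n t ht))).mul (hGc n t ht)
    have hrM : ∀ x, |r x| ≤ ∑ _i : ι, (M + 1 * M) * L := fun x =>
      abs_sum_le fun i => abs_mul_le ((abs_add_le _ _).trans (add_le_add (hwxM i t ht x)
        (abs_mul_le (abs_weight_logDeriv_le x) (hwM i t ht x)))) (hGM i t ht x)
    have hrint := integrable_weight_mul hrc hrM
    -- Integration by parts: the integrand is the derivative of the integrable function `(1 + x²)⁻¹
    -- ∑ w_n G_n`. Since `∂_x G_n = 2 ∂_t w_n`, its second term is exactly the integrand of the time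
    -- derivative of the energy.
    have hzero : ∫ x, ((1 + x ^ 2)⁻¹ * r x + (1 + x ^ 2)⁻¹ * e' t x) = 0 := by
      refine integral_eq_zero_of_hasDerivAt_of_integrable
        (f := fun x => (1 + x ^ 2)⁻¹ * ∑ n, w n t x * G n t x) (fun x => ?_)
        (hrint.add (hint' t ht)) ?_
      · refine ((hasDerivAt_weight x).mul (HasDerivAt.fun_sum fun n _ =>
          (hwx n t ht x).fun_mul (hG n t ht x))).congr_deriv ?_
        simp only [hr, he', mul_assoc, ← mul_add, ← Finset.sum_add_distrib, Finset.mul_sum]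
        refine Finset.sum_congr rfl fun n _ => ?_
        ring
      · exact integrable_weight_mul
          (continuous_finsetSum _ fun n _ => (hwc n t ht).mul (hGc n t ht))
          (fun x => abs_sum_le fun i => abs_mul_le (hwM i t ht x) (hGM i t ht x))
    rw [integral_add hrint (hint' t ht)] at hzero
    have hle : ∫ x, -((1 + x ^ 2)⁻¹ * r x) ≤ ∫ x, K * ((1 + x ^ 2)⁻¹ * e t x) := by
      refine integral_mono hrint.neg ((hint t ht).const_mul K) fun x => ?_
      have := hK (fun n => w n t x) (fun n => wx n t x) (fun n => G n t x) _
        (abs_weight_logDeriv_le x) (fun n => hGle n t ht x) (hcoer t ht x)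
      have := mul_le_mul_of_nonneg_left this (hwpos x).le
      simp only [he, hr]
      linarith
    rw [integral_neg, integral_const_mul] at hle
    linarith
  have hE0 : E 0 = 0 := by simp [hE, he, hw0]
  have hanti : AntitoneOn (fun t => Real.exp (-K * t) * E t) (Set.Icc 0 T) := by
    have hd : ∀ t ∈ Set.Ioo 0 T, HasDerivAt (fun t => Real.exp (-K * t) * E t)
        (Real.exp (-K * t) * ((∫ x, (1 + x ^ 2)⁻¹ * e' t x) - K * E t)) t := by
      intro t ht
      have h1 : HasDerivAt (fun t => Real.exp (-K * t)) (Real.exp (-K * t) * -K) t := by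
        simpa using ((hasDerivAt_id t).const_mul (-K)).exp
      refine (h1.mul (hEd t ht)).congr_deriv ?_
      ring
    refine antitoneOn_of_deriv_nonpos (convex_Icc _ _) ?_ ?_ ?_
    · exact (by fun_prop : Continuous fun t => Real.exp (-K * t)).continuousOn.mul hEc
    · rw [interior_Icc]
      exact fun t ht => (hd t ht).differentiableAt.differentiableWithinAt
    · rw [interior_Icc]
      intro t ht
      rw [(hd t ht).deriv]
      refine mul_nonpos_of_nonneg_of_nonpos (Real.exp_pos _).le ?_
      linarith [hEd_le t (Set.Ioo_subset_Icc_self ht)]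
  intro n t ht x
  have hEt : E t ≤ 0 := by
    have := hanti h0T ht ht.1
    simp only [hE0, mul_zero] at this
    exact nonpos_of_mul_nonpos_right this (Real.exp_pos _)
  have hnn : ∀ x, 0 ≤ (1 + x ^ 2)⁻¹ * e t x := fun x =>
    mul_nonneg (hwpos x).le (Finset.sum_nonneg fun _ _ => sq_nonneg _)
  have hEt0 : E t = 0 := le_antisymm hEt (integral_nonneg hnn)
  have hae := (integral_eq_zero_iff_of_nonneg hnn (hint t ht)).1 hEt0
  have hcont : Continuous fun x : ℝ => (1 + x ^ 2)⁻¹ * e t x :=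
    (Continuous.inv₀ (by fun_prop) fun x => by positivity).mul (hec t ht)
  have hx := congrFun ((hcont.ae_eq_iff_eq volume continuous_zero).1 hae) x
  have hx' : e t x = 0 := by
    rcases mul_eq_zero.1 hx with h | h
    · exact absurd h (hwpos x).ne'
    · exact h
  have := (Finset.sum_eq_zero_iff_of_nonneg fun i _ => sq_nonneg (w i t x)).1 hx' n
    (Finset.mem_univ n)
  exact pow_eq_zero_iff two_ne_zero |>.1 this

/-! ### Algebra of the small range condition -/

theorem sq_sum_le_sum_div_mul {ι : Type*} (s : Finset ι) {f : ι → ℝ} (hf : ∀ i, 0 < f i)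
    (a ξ : ι → ℝ) :
    (∑ i ∈ s, a i * ξ i) ^ 2 ≤ (∑ i ∈ s, a i ^ 2 / f i) * ∑ i ∈ s, f i * ξ i ^ 2 :=
  Finset.sum_sq_le_sum_mul_sum_of_sq_le_mul s
    (fun i _ => div_nonneg (sq_nonneg _) (hf i).le)
    (fun i _ => mul_nonneg (hf i).le (sq_nonneg _))
    (fun i _ => le_of_eq (by have := (hf i).ne'; field_simp))

/-- The least eigenvalue of the symmetrized rank one form `(∑ ξ_i) (∑ f_i ξ_i)` relative to
`∑ f_i ξ_i²`. -/
theorem sum_mul_sum_ge {ι : Type*} (s : Finset ι) (hs : s.Nonempty) {f : ι → ℝ}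
    (hf : ∀ i, 0 < f i) (ξ : ι → ℝ) :
    1 / 2 * (s.card - √((∑ i ∈ s, f i) * ∑ i ∈ s, 1 / f i)) * ∑ i ∈ s, f i * ξ i ^ 2
      ≤ (∑ i ∈ s, ξ i) * ∑ i ∈ s, f i * ξ i := by
  set a := ∑ i ∈ s, f i with ha
  set b := ∑ i ∈ s, 1 / f i with hb
  have ha0 : 0 < a := Finset.sum_pos (fun i _ => hf i) hs
  have hb0 : 0 < b := Finset.sum_pos (fun i _ => one_div_pos.2 (hf i)) hs
  -- `4 l X Y = (l X + Y)² - (l X - Y)²`, and Cauchy–Schwarz with weights `f` bounds the last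
  -- square. This `l` minimises `l b + a / l`, hence gives the best constant.
  set l := √(a / b) with hl
  have hl0 : 0 < l := Real.sqrt_pos.2 (div_pos ha0 hb0)
  have hl2 : l ^ 2 * b = a := by rw [hl, Real.sq_sqrt (by positivity)]; field_simp
  have hab : √(a * b) = l * b := by
    rw [← hl2, show l ^ 2 * b * b = (l * b) ^ 2 by ring, Real.sqrt_sq (by positivity)]
  have key := sq_sum_le_sum_div_mul s hf (fun i => l - f i) ξ
  have e1 : ∑ i ∈ s, (l - f i) * ξ i = l * ∑ i ∈ s, ξ i - ∑ i ∈ s, f i * ξ i := by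
    rw [Finset.mul_sum, ← Finset.sum_sub_distrib]
    exact Finset.sum_congr rfl fun _ _ => by ring
  have e2 : ∑ i ∈ s, (l - f i) ^ 2 / f i = l ^ 2 * b - 2 * l * s.card + a := by
    rw [hb, ha, Finset.mul_sum, Finset.cast_card, Finset.mul_sum, ← Finset.sum_sub_distrib,
      ← Finset.sum_add_distrib]
    refine Finset.sum_congr rfl fun i _ => ?_
    have := (hf i).ne'
    field_simp
    ring
  rw [e1, e2] at key
  rw [hab]
  set X := ∑ i ∈ s, ξ i
  set Y := ∑ i ∈ s, f i * ξ i
  set Z := ∑ i ∈ s, f i * ξ i ^ 2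
  rw [show l ^ 2 * b - 2 * l * s.card + a = 2 * (l ^ 2 * b) - 2 * l * s.card by linarith] at key
  have h4 : 0 ≤ l * (X * Y - 1 / 2 * (s.card - l * b) * Z) := by
    nlinarith [sq_nonneg (l * X + Y)]
  linarith [nonneg_of_mul_nonneg_right h4 hl0]

variable {N : ℕ}

theorem fmin_le (f : Fin N → ℝ) (n : Fin N) : fmin f ≤ f n :=
  ciInf_le (Set.finite_range f).bddBelow n

theorem fmin_pos (hN : 2 ≤ N) {f : Fin N → ℝ} (hf : ∀ n, 0 < f n) : 0 < fmin f := by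
  have : Nonempty (Fin N) := ⟨⟨0, by omega⟩⟩
  obtain ⟨n, hn⟩ := exists_eq_ciInf_of_finite (f := f)
  rw [fmin, ← hn]
  exact hf n

/-- Both terms on the right of the condition are nonnegative, so each entry of the minimum yields
one bound. The slack can be dropped: strict coercivity will come from `ε`. -/
theorem SmallRange.bounds (hN : 2 ≤ N) {f : Fin N → ℝ} (hf : ∀ n, 0 < f n)
    (h : SmallRange f) :
    (∀ k, √((∑ n ∈ Finset.univ.erase k, f n) * ∑ n ∈ Finset.univ.erase k, 1 / f n) ≤ N + 1) ∧
      √(∑ n, (f n - fbar f) ^ 2) ≤ fmin f := by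
  have hm := fmin_pos hN hf
  have hmM : fmin f ≤ fmax f :=
    (fmin_le f ⟨0, by omega⟩).trans (le_ciSup (Set.finite_range f).bddAbove _)
  have h1 : 0 ≤ (fmax f - fmin f) / fmin f := div_nonneg (by linarith) hm.le
  have h2 : 0 ≤ 1 / fmin f * √(∑ n, (f n - fbar f) ^ 2) := by positivity
  rw [SmallRange, gt_iff_lt, lt_min_iff] at h
  refine ⟨fun k => ?_, ?_⟩
  · have := le_ciSup (f := fun k : Fin N =>
      √((∑ n ∈ Finset.univ.erase k, f n) * ∑ n ∈ Finset.univ.erase k, 1 / f n))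
      (Set.finite_range _).bddAbove k
    linarith [h.1]
  · have h3 : 1 / fmin f * √(∑ n, (f n - fbar f) ^ 2) ≤ 1 := by linarith [h.2]
    rw [one_div, inv_mul_le_iff₀ hm] at h3
    linarith

/-- Nonnegativity of the limit form at the `k`-th vertex, on vectors of zero sum. -/
theorem mul_sum_le_sum_sq {f : Fin N → ℝ} (hN : 2 ≤ N) (hf : ∀ n, 0 < f n)
    {ξ : Fin N → ℝ} (hξ : ∑ n, ξ n = 0) (k : Fin N)
    (hk : √((∑ n ∈ Finset.univ.erase k, f n) * ∑ n ∈ Finset.univ.erase k, 1 / f n) ≤ N + 1) :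
    ξ k * ∑ n, f n * ξ n ≤ ∑ n, f n * ξ n ^ 2 := by
  have hcard : (Finset.univ.erase k).card = N - 1 := by simp
  have hne : (Finset.univ.erase k).Nonempty := Finset.card_pos.1 (by omega)
  have key := sum_mul_sum_ge _ hne hf ξ
  rw [hcard, Nat.cast_sub (by omega), Nat.cast_one] at key
  have e1 := Finset.add_sum_erase Finset.univ ξ (Finset.mem_univ k)
  have e2 := Finset.add_sum_erase Finset.univ (fun n => f n * ξ n) (Finset.mem_univ k)
  have e3 := Finset.add_sum_erase Finset.univ (fun n => f n * ξ n ^ 2) (Finset.mem_univ k)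
  rw [← e2, ← e3]
  -- Zero sum makes `ξ k` minus the sum of the other `N - 1` entries. The constant `½ (N - 1 - √⋯)`
  -- in `key` is at least `-1` exactly when the root is at most `N + 1`.
  have hX : ∑ n ∈ Finset.univ.erase k, ξ n = -ξ k := by linarith
  rw [hX] at key
  have hZ : 0 ≤ ∑ n ∈ Finset.univ.erase k, f n * ξ n ^ 2 :=
    Finset.sum_nonneg fun i _ => mul_nonneg (hf i).le (sq_nonneg _)
  nlinarith [mul_nonneg (sub_nonneg.2 hk) hZ]

/-! ### The nonlinearity and its Jacobian -/

/-- The nonlinearity `B^ε_n(u) u_n`. -/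
noncomputable def nonlin (ε : ℝ) (f : Fin N → ℝ) (n : Fin N) (u : Fin N → ℝ) : ℝ := B ε f u n * u n

/-- The derivative of `nonlin` at `u` in the direction `ξ`. -/
noncomputable def nonlinDeriv (ε : ℝ) (f : Fin N → ℝ) (n : Fin N) (u ξ : Fin N → ℝ) : ℝ :=
  (f n * (∑ k, ξ k) * u n + (ε + f n * ∑ k, u k) * ξ n) / (ε + ∑ k, f k * u k)
    - (ε + f n * ∑ k, u k) * u n * (∑ k, f k * ξ k) / (ε + ∑ k, f k * u k) ^ 2

section

variable {ε : ℝ} {f : Fin N → ℝ}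

theorem denom_ge (hf : ∀ n, 0 < f n) {u : Fin N → ℝ} (hu : ∀ n, 0 ≤ u n) :
    ε ≤ ε + ∑ k, f k * u k :=
  le_add_of_nonneg_right (Finset.sum_nonneg fun k _ => mul_nonneg (hf k).le (hu k))

theorem hasDerivAt_nonlin (n : Fin N) {u ux : Fin N → ℝ → ℝ} {x : ℝ}
    (hu : ∀ k, HasDerivAt (u k) (ux k x) x) (h0 : ε + ∑ k, f k * u k x ≠ 0) :
    HasDerivAt (fun y => nonlin ε f n fun k => u k y)
      (nonlinDeriv ε f n (fun k => u k x) fun k => ux k x) x := by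
  have hs : HasDerivAt (fun y => ∑ k, u k y) (∑ k, ux k x) x :=
    HasDerivAt.fun_sum fun k _ => hu k
  have hD : HasDerivAt (fun y => ε + ∑ k, f k * u k y) (∑ k, f k * ux k x) x :=
    (HasDerivAt.fun_sum fun k _ => (hu k).const_mul (f k)).const_add ε
  refine ((((hs.const_mul (f n)).const_add ε).fun_div hD h0).fun_mul (hu n)).congr_deriv ?_
  simp only [nonlinDeriv]
  field_simp
  ring

/-- The numerators add up to `ε s + s V = s (ε + V)`, with `s = ∑ u_k` and `V = ∑ f_k u_k`, so the
denominator cancels. This decouples the total density from the system. -/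
theorem sum_nonlin {u : Fin N → ℝ} (h0 : ε + ∑ k, f k * u k ≠ 0) :
    ∑ n, nonlin ε f n u = ∑ n, u n := by
  have : ∀ n, nonlin ε f n u =
      (ε * u n + (∑ k, u k) * (f n * u n)) / (ε + ∑ k, f k * u k) := fun n => by
    rw [nonlin, B]; ring
  simp only [this]
  rw [← Finset.sum_div, Finset.sum_add_distrib, ← Finset.mul_sum, ← Finset.mul_sum,
    div_eq_iff h0]
  ring

theorem sum_nonlinDeriv {u ξ : Fin N → ℝ} (h0 : ε + ∑ k, f k * u k ≠ 0) :
    ∑ n, nonlinDeriv ε f n u ξ = ∑ n, ξ n := by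
  set s := ∑ k, u k with hs
  set X := ∑ k, ξ k with hX
  set Y := ∑ k, f k * ξ k with hY
  set V := ∑ k, f k * u k with hV
  have : ∀ n, nonlinDeriv ε f n u ξ =
      (X * (f n * u n) + ε * ξ n + s * (f n * ξ n)) / (ε + V)
        - (ε * u n + s * (f n * u n)) * (Y / (ε + V) ^ 2) := fun n => by
    rw [nonlinDeriv]; ring
  simp only [this]
  rw [Finset.sum_sub_distrib, ← Finset.sum_div, ← Finset.sum_mul]
  simp only [Finset.sum_add_distrib, ← Finset.mul_sum]
  rw [← hs, ← hX, ← hY, ← hV]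
  field_simp
  ring

/-- Coercivity of the derivative of the nonlinearity on vectors of zero sum. -/
theorem sum_mul_nonlinDeriv_ge (hN : 2 ≤ N) (hf : ∀ n, 0 < f n) (h : SmallRange f)
    (hε : 0 < ε) {u ξ : Fin N → ℝ} (hu : ∀ n, 0 ≤ u n) (hξ : ∑ n, ξ n = 0) :
    ε ^ 2 / (ε + ∑ k, f k * u k) ^ 2 * ∑ n, ξ n ^ 2 ≤ ∑ n, ξ n * nonlinDeriv ε f n u ξ := by
  obtain ⟨hvert, hvar⟩ := h.bounds hN hf
  have hDpos : 0 < ε + ∑ k, f k * u k := hε.trans_le (denom_ge hf hu)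
  set s := ∑ k, u k with hs
  set Y := ∑ k, f k * ξ k with hY
  set V := ∑ k, f k * u k with hV
  set R := ∑ n, ξ n ^ 2 with hR
  set Z := ∑ n, f n * ξ n ^ 2 with hZ
  have hR0 : 0 ≤ R := Finset.sum_nonneg fun _ _ => sq_nonneg _
  have hZ0 : 0 ≤ Z := Finset.sum_nonneg fun i _ => mul_nonneg (hf i).le (sq_nonneg _)
  have hs0 : 0 ≤ s := Finset.sum_nonneg fun i _ => hu i
  have hsV : fmin f * s ≤ V := by
    rw [hs, Finset.mul_sum]
    exact Finset.sum_le_sum fun i _ => mul_le_mul_of_nonneg_right (fmin_le f i) (hu i)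
  -- the part of the form that is present for `ε = 0`
  have h1 : Y * ∑ n, f n * u n * ξ n ≤ V * Z := by
    rw [hV, Finset.mul_sum, Finset.sum_mul]
    refine Finset.sum_le_sum fun k _ => ?_
    -- Both sides are linear in the nonnegative weights `f_k u_k`, so it suffices to compare them at
    -- each vertex.
    have := mul_le_mul_of_nonneg_left (mul_sum_le_sum_sq hN hf hξ k (hvert k))
      (mul_nonneg (hf k).le (hu k))
    linarith
  -- the mean of `f` may be subtracted in `Y`
  have hYv : |Y| ≤ fmin f * √R := by
    have e : Y = ∑ n, (f n - fbar f) * ξ n := by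
      simp only [sub_mul, Finset.sum_sub_distrib, ← Finset.mul_sum, hξ]
      rw [hY]; ring
    have := Finset.sum_mul_sq_le_sq_mul_sq Finset.univ (fun n => f n - fbar f) ξ
    rw [← e] at this
    have h2 := Real.abs_le_sqrt this
    rw [Real.sqrt_mul (Finset.sum_nonneg fun _ _ => sq_nonneg _)] at h2
    exact h2.trans (mul_le_mul_of_nonneg_right hvar (Real.sqrt_nonneg _))
  have huξ : |∑ n, u n * ξ n| ≤ s * √R := by
    refine (Finset.abs_sum_le_sum_abs _ _).trans ?_
    rw [hs, Finset.sum_mul]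
    refine Finset.sum_le_sum fun i _ => ?_
    rw [abs_mul, abs_of_nonneg (hu i)]
    refine mul_le_mul_of_nonneg_left (Real.abs_le_sqrt ?_) (hu i)
    exact Finset.single_le_sum (f := fun n => ξ n ^ 2) (fun _ _ => sq_nonneg _)
      (Finset.mem_univ i)
  have h2 : Y * ∑ n, u n * ξ n ≤ V * R := by
    calc Y * ∑ n, u n * ξ n ≤ |Y| * |∑ n, u n * ξ n| := by
          rw [← abs_mul]; exact le_abs_self _
      _ ≤ (fmin f * √R) * (s * √R) := mul_le_mul hYv huξ (abs_nonneg _)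
          ((abs_nonneg _).trans hYv)
      _ = fmin f * s * R := by
          rw [show fmin f * √R * (s * √R) = fmin f * s * (√R * √R) by ring,
            Real.mul_self_sqrt hR0]
      _ ≤ V * R := mul_le_mul_of_nonneg_right hsV hR0
  have hform : ∑ n, ξ n * nonlinDeriv ε f n u ξ =
      ((ε + V) * (ε * R + s * Z)
        - Y * (ε * ∑ n, u n * ξ n + s * ∑ n, f n * u n * ξ n)) / (ε + V) ^ 2 := by
    have : ∀ n, ξ n * nonlinDeriv ε f n u ξ =
        (ε * ξ n ^ 2 + s * (f n * ξ n ^ 2)) / (ε + V)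
          - (ε * (u n * ξ n) + s * (f n * u n * ξ n)) * (Y / (ε + V) ^ 2) := fun n => by
      rw [nonlinDeriv, hξ]; ring
    simp only [this]
    rw [Finset.sum_sub_distrib, ← Finset.sum_div, ← Finset.sum_mul]
    simp only [Finset.sum_add_distrib, ← Finset.mul_sum]
    rw [← hR, ← hZ]
    field_simp
  rw [hform, div_mul_eq_mul_div]
  refine div_le_div_of_nonneg_right ?_ (by positivity)
  -- `h1` and `h2` absorb the negative terms into `s V Z` and `ε V R`; what is left of the numerator
  -- is `ε² R + ε s Z`.
  have a1 := mul_le_mul_of_nonneg_left h1 hs0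
  have a2 := mul_le_mul_of_nonneg_left h2 hε.le
  have a3 : 0 ≤ ε * s * Z := by positivity
  nlinarith

end

/-! ### Consequences of the regularity assumptions -/

theorem ContStrip.continuous {T : ℝ} {φ : ℝ → ℝ → ℝ} (h : ContStrip T φ) {t : ℝ}
    (ht : t ∈ Set.Icc 0 T) : Continuous (φ t) :=
  ContinuousOn.comp_continuous (f := fun x : ℝ => (t, x)) h (by fun_prop) fun _ =>
    ⟨ht, Set.mem_univ _⟩

theorem VolatilityAssumption.contDiff {σ : ℝ → ℝ → ℝ} (hσ : VolatilityAssumption σ) {t : ℝ}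
    (ht : 0 ≤ t) : ContDiff ℝ ∞ (σ t) :=
  contDiffOn_univ.1 <| hσ.smooth.comp (f := fun x : ℝ => (t, x))
    (by fun_prop : ContDiff ℝ ∞ fun x : ℝ => (t, x)).contDiffOn fun _ _ => ⟨ht, Set.mem_univ _⟩

/-- A horizontal line stays in the half-plane, even at `t = 0`, so the derivative within the
half-plane, applied to the unit vector `(0, 1)`, is the full derivative of the slice. -/
theorem VolatilityAssumption.exists_deriv_bound {σ : ℝ → ℝ → ℝ} (hσ : VolatilityAssumption σ) :
    ∃ C : ℝ, ∀ t, 0 ≤ t → ∀ x, |deriv (σ t) x| ≤ C := by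
  obtain ⟨C, hC⟩ := hσ.bdd_deriv 1 le_rfl
  refine ⟨C, fun t ht x => ?_⟩
  set S : Set (ℝ × ℝ) := Set.Ici 0 ×ˢ Set.univ
  have hS : UniqueDiffOn ℝ S := (uniqueDiffOn_Ici 0).prod uniqueDiffOn_univ
  have hmem : (t, x) ∈ S := ⟨ht, Set.mem_univ _⟩
  have h1 := ((hσ.smooth (t, x) hmem).differentiableWithinAt (by simp)).hasFDerivWithinAt
  have h2 : HasDerivWithinAt (fun y : ℝ => (t, y)) ((0 : ℝ), (1 : ℝ)) Set.univ x :=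
    ((hasDerivAt_const x t).prodMk (hasDerivAt_id x)).hasDerivWithinAt
  have h3 := h1.comp_hasDerivWithinAt x h2 fun _ _ => ⟨ht, Set.mem_univ _⟩
  have h4 : HasDerivAt (σ t) _ x := hasDerivWithinAt_univ.1 h3
  have h5 := hC (t, x) hmem
  rw [norm_iteratedFDerivWithin_one _ (hS _ hmem)] at h5
  rw [h4.deriv, ← Real.norm_eq_abs]
  refine (ContinuousLinearMap.le_opNorm _ _).trans ?_
  simpa [Prod.norm_def] using h5

variable {ε : ℝ} {f : Fin N → ℝ}

theorem nonlinDeriv_sub (n : Fin N) (u ξ η : Fin N → ℝ) :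
    nonlinDeriv ε f n u ξ - nonlinDeriv ε f n u η
      = nonlinDeriv ε f n u fun k => ξ k - η k := by
  simp only [nonlinDeriv, mul_sub, Finset.sum_sub_distrib]
  ring

theorem norm_le_sum_abs {ι : Type*} [Fintype ι] (u : ι → ℝ) : ‖u‖ ≤ ∑ i, |u i| :=
  (pi_norm_le_iff_of_nonneg (Finset.sum_nonneg fun _ _ => abs_nonneg _)).2 fun i =>
    Finset.single_le_sum (f := fun i => |u i|) (fun _ _ => abs_nonneg _) (Finset.mem_univ i)

/-- The nonlinearity and its derivative are Lipschitz on bounded sets of nonnegative vectors. -/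
theorem exists_lipschitz_nonlin (hf : ∀ n, 0 < f n) (hε : 0 < ε) (M : ℝ) :
    ∃ L : ℝ, 0 ≤ L ∧ ∀ u v ξ η : Fin N → ℝ, (∀ n, 0 ≤ u n) → (∀ n, 0 ≤ v n) →
      (∀ n, |u n| ≤ M) → (∀ n, |v n| ≤ M) → (∀ n, |ξ n| ≤ M) → (∀ n, |η n| ≤ M) → ∀ n,
      |nonlin ε f n u - nonlin ε f n v| ≤ L * ∑ k, |u k - v k| ∧
      |nonlinDeriv ε f n u ξ - nonlinDeriv ε f n v η|
        ≤ L * (∑ k, |u k - v k| + ∑ k, |ξ k - η k|) := by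
  -- On this compact convex set the denominator is at least `ε`, so both maps are `C¹` and hence
  -- Lipschitz.
  set K : Set ((Fin N → ℝ) × (Fin N → ℝ)) :=
    Set.Icc 0 (fun _ => M) ×ˢ Set.Icc (fun _ => -M) (fun _ => M) with hK
  set H : (Fin N → ℝ) × (Fin N → ℝ) → (Fin N → ℝ) × (Fin N → ℝ) := fun z =>
    (fun n => nonlin ε f n z.1, fun n => nonlinDeriv ε f n z.1 z.2) with hH
  have hcomp : IsCompact K := isCompact_Icc.prod isCompact_Icc
  have hconv : Convex ℝ K := (convex_Icc _ _).prod (convex_Icc _ _)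
  have hcd : ContDiffOn ℝ 1 H K := by
    have hD : ContDiffOn ℝ 1 (fun z : (Fin N → ℝ) × (Fin N → ℝ) => ε + ∑ k, f k * z.1 k) K :=
      (by fun_prop : ContDiff ℝ 1 _).contDiffOn
    have hD0 : ∀ z ∈ K, ε + ∑ k, f k * z.1 k ≠ 0 := fun z hz =>
      (hε.trans_le (denom_ge hf fun n => hz.1.1 n)).ne'
    refine ContDiffOn.prodMk (contDiffOn_pi.2 fun n => ?_) (contDiffOn_pi.2 fun n => ?_)
    · refine ContDiffOn.mul (ContDiffOn.div ?_ hD hD0) ?_ <;>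
        exact (by fun_prop : ContDiff ℝ 1 _).contDiffOn
    · refine ContDiffOn.sub (ContDiffOn.div ?_ hD hD0)
        (ContDiffOn.div ?_ (hD.pow 2) fun z hz => pow_ne_zero 2 (hD0 z hz)) <;>
        exact (by fun_prop : ContDiff ℝ 1 _).contDiffOn
  obtain ⟨L, hL⟩ := hcd.exists_lipschitzOnWith one_ne_zero hconv hcomp
  refine ⟨L, L.2, fun u v ξ η hu hv huM hvM hξ hη n => ?_⟩
  have hmem : ∀ {u ξ : Fin N → ℝ}, (∀ n, 0 ≤ u n) → (∀ n, |u n| ≤ M) → (∀ n, |ξ n| ≤ M) →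
      (u, ξ) ∈ K := fun h0 h1 h2 =>
    ⟨⟨h0, fun n => (abs_le.1 (h1 n)).2⟩, fun n => (abs_le.1 (h2 n)).1,
      fun n => (abs_le.1 (h2 n)).2⟩
  have hu1 : ∀ {ξ η : Fin N → ℝ}, (∀ n, |ξ n| ≤ M) → (∀ n, |η n| ≤ M) →
      ‖H (u, ξ) - H (v, η)‖ ≤ L * (∑ k, |u k - v k| + ∑ k, |ξ k - η k|) := fun {ξ η} hξ hη => by
    refine (hL.norm_sub_le (hmem hu huM hξ) (hmem hv hvM hη)).trans
      (mul_le_mul_of_nonneg_left ?_ L.2)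
    rw [Prod.mk_sub_mk, Prod.norm_mk]
    have h1 := norm_le_sum_abs (u - v)
    have h2 := norm_le_sum_abs (ξ - η)
    have h3 := norm_nonneg (u - v)
    have h4 := norm_nonneg (ξ - η)
    simp only [Pi.sub_apply] at h1 h2
    exact max_le (by linarith) (by linarith)
  constructor
  · have h := hu1 hξ hξ
    simp only [sub_self, abs_zero, Finset.sum_const_zero, add_zero] at h
    exact (norm_le_pi_norm (H (u, ξ) - H (v, ξ)).1 n).trans ((norm_fst_le _).trans h)
  · exact (norm_le_pi_norm (H (u, ξ) - H (v, η)).2 n).trans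
      ((norm_snd_le _).trans (hu1 hξ hη))

theorem exists_bound {T β : ℝ} {p : Fin N → ℝ → ℝ → ℝ} (hp : ∀ n, ParabolicHolder T β (p n)) :
    ∃ M : ℝ, ∀ n, ∀ t ∈ Set.Icc 0 T, ∀ x,
      |p n t x| ≤ M ∧ |dx (p n) t x| ≤ M ∧ |dt T (p n) t x| ≤ M := by
  choose C₀ h₀ using fun n => (hp n).bdd
  choose C₁ h₁ using fun n => (hp n).bdd_x
  choose C₂ h₂ using fun n => (hp n).bdd_t
  refine ⟨∑ n, (|C₀ n| + |C₁ n| + |C₂ n|), fun n t ht x => ?_⟩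
  have h := Finset.single_le_sum (f := fun n => |C₀ n| + |C₁ n| + |C₂ n|)
    (fun _ _ => by positivity) (Finset.mem_univ n)
  have a₀ := abs_nonneg (C₀ n)
  have a₁ := abs_nonneg (C₁ n)
  have a₂ := abs_nonneg (C₂ n)
  refine ⟨?_, ?_, ?_⟩
  · linarith [h₀ n t ht x, le_abs_self (C₀ n)]
  · linarith [h₁ n t ht x, le_abs_self (C₁ n)]
  · linarith [h₂ n t ht x, le_abs_self (C₂ n)]

/-! ### Divergence form of the system -/

section Flux

variable {T β : ℝ} {σ : ℝ → ℝ → ℝ} {p : Fin N → ℝ → ℝ → ℝ}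

theorem dx_flux_eq (hf : ∀ n, 0 < f n) (hε : 0 < ε) (hσ : VolatilityAssumption σ)
    (hp : ∀ n, ParabolicHolder T β (p n)) {t : ℝ} (ht : t ∈ Set.Icc 0 T)
    (h0 : ∀ n x, 0 ≤ p n t x) (n : Fin N) (x : ℝ) :
    HasDerivAt (flux ε f σ p n t) (dx (flux ε f σ p n) t x) x ∧
    dx (flux ε f σ p n) t x = 2 * σ t x * deriv (σ t) x * nonlin ε f n (fun k => p k t x)
      + σ t x ^ 2 * nonlinDeriv ε f n (fun k => p k t x) fun k => dx (p k) t x := by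
  have hs : HasDerivAt (σ t) (deriv (σ t) x) x :=
    ((hσ.contDiff ht.1).differentiable (by simp) x).hasDerivAt
  have hn := hasDerivAt_nonlin (ε := ε) (f := f) n (u := fun k => p k t)
    (ux := fun k => dx (p k) t) (x := x)
    (fun k => ((hp k).diff_x t ht x).hasDerivAt) (hε.trans_le (denom_ge hf fun k => h0 k x)).ne'
  have h : HasDerivAt (flux ε f σ p n t)
      (2 * σ t x * deriv (σ t) x * nonlin ε f n (fun k => p k t x)
      + σ t x ^ 2 * nonlinDeriv ε f n (fun k => p k t x) fun k => dx (p k) t x) x := by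
    have e : flux ε f σ p n t = fun y => σ t y ^ 2 * nonlin ε f n fun k => p k t y := by
      ext y
      simp only [flux, nonlin]
      ring
    rw [e]
    refine ((hs.fun_pow 2).fun_mul hn).congr_deriv ?_
    push_cast
    ring
  have e : dx (flux ε f σ p n) t x = _ := h.deriv
  exact ⟨e ▸ h, e⟩

/-- The second derivative in the equation is a `deriv`, which carries information only once
differentiability is known. -/
theorem differentiable_dx_flux (hf : ∀ n, 0 < f n) (hε : 0 < ε) (hσ : VolatilityAssumption σ)
    (hp : ∀ n, ParabolicHolder T β (p n)) {t : ℝ} (ht : t ∈ Set.Icc 0 T)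
    (h0 : ∀ n x, 0 ≤ p n t x) (n : Fin N) : Differentiable ℝ (dx (flux ε f σ p n) t) := by
  rw [funext fun x => (dx_flux_eq hf hε hσ hp ht h0 n x).2]
  have hσ1 : Differentiable ℝ (σ t) := (hσ.contDiff ht.1).differentiable (by simp)
  have hσ2 : Differentiable ℝ (deriv (σ t)) :=
    ((contDiff_infty_iff_deriv.1 (hσ.contDiff ht.1)).2).differentiable (by simp)
  have hp1 : ∀ k, Differentiable ℝ (p k t) := fun k => (hp k).diff_x t ht
  have hp2 : ∀ k, Differentiable ℝ (dx (p k) t) := fun k => (hp k).diff_xx t ht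
  have hD0 : ∀ x, ε + ∑ k, f k * p k t x ≠ 0 := fun x =>
    (hε.trans_le (denom_ge hf fun k => h0 k x)).ne'
  have hD : Differentiable ℝ fun x => ε + ∑ k, f k * p k t x := by fun_prop
  have hd : Differentiable ℝ fun x =>
      nonlinDeriv ε f n (fun k => p k t x) fun k => dx (p k) t x := by
    simp only [nonlinDeriv]
    exact (Differentiable.fun_div (by fun_prop) hD hD0).fun_sub
      (Differentiable.fun_div (by fun_prop) (hD.fun_pow 2) fun x => pow_ne_zero 2 (hD0 x))
  have hn : Differentiable ℝ fun x => nonlin ε f n fun k => p k t x := by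
    simp only [nonlin, B]
    exact (Differentiable.fun_div (by fun_prop) hD hD0).fun_mul (hp1 n)
  fun_prop

theorem IsSolution.hasDerivAt_current {m : Fin N → ℝ} {P : Fin N → ℝ → ℝ}
    (hf : ∀ n, 0 < f n) (hε : 0 < ε)
    (hσ : VolatilityAssumption σ) (hp : ∀ n, ParabolicHolder T β (p n))
    (hps : IsSolution T ε f σ m P p) (n : Fin N) {t : ℝ} (ht : t ∈ Set.Icc 0 T) (x : ℝ) :
    HasDerivAt (fun y => dx (flux ε f σ p n) t y + flux ε f σ p n t y)
      (2 * dt T (p n) t x) x := by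
  have h0 : ∀ n x, 0 ≤ p n t x := fun n x => hps.nonneg n t ht x
  refine ((differentiable_dx_flux hf hε hσ hp ht h0 n x).hasDerivAt.fun_add
    (dx_flux_eq hf hε hσ hp ht h0 n x).1).congr_deriv ?_
  rw [hps.pde n t ht x]
  simp only [dx]
  ring

end Flux

end LSV

/-! ### Comparison of two solutions -/

open LSV in
theorem mainTheorem4 (N : ℕ) (hN : 2 ≤ N) (f : Fin N → ℝ) (hf : ∀ n, 0 < f n)
    (hcond : LSV.SmallRange f)
    (T ε α : ℝ) (hT : 0 < T) (hε : 0 < ε) (hα : α ∈ Set.Ioo (0 : ℝ) 1)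
    (σ : ℝ → ℝ → ℝ) (hσ : LSV.VolatilityAssumption σ)
    (m : Fin N → ℝ) (P : Fin N → ℝ → ℝ) (hP : LSV.InitialDensities m P)
    (hPα : ∀ n, LSV.HolderTwo α (P n))
    (p q : Fin N → ℝ → ℝ → ℝ)
    (hp : ∀ n, LSV.ParabolicHolder T (α / 2) (p n)) (hps : LSV.IsSolution T ε f σ m P p)
    (hq : ∀ n, LSV.ParabolicHolder T (α / 2) (q n)) (hqs : LSV.IsSolution T ε f σ m P q) :
    ∀ n, ∀ t ∈ Set.Icc 0 T, ∀ x : ℝ, p n t x = q n t x := by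
  have : Nonempty (Fin N) := ⟨⟨0, by omega⟩⟩
  obtain ⟨σ₀, σ₁, hσ₀, hσ₀₁, hσb⟩ := hσ.bounds
  obtain ⟨D, hD⟩ := hσ.exists_deriv_bound
  obtain ⟨M₁, hM₁⟩ := exists_bound hp
  obtain ⟨M₂, hM₂⟩ := exists_bound hq
  set M := max M₁ M₂ with hM
  have hMp : ∀ n, ∀ t ∈ Set.Icc 0 T, ∀ x,
      |p n t x| ≤ M ∧ |dx (p n) t x| ≤ M ∧ |dt T (p n) t x| ≤ M := fun n t ht x =>
    ⟨(hM₁ n t ht x).1.trans (le_max_left _ _), (hM₁ n t ht x).2.1.trans (le_max_left _ _),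
      (hM₁ n t ht x).2.2.trans (le_max_left _ _)⟩
  have hMq : ∀ n, ∀ t ∈ Set.Icc 0 T, ∀ x,
      |q n t x| ≤ M ∧ |dx (q n) t x| ≤ M ∧ |dt T (q n) t x| ≤ M := fun n t ht x =>
    ⟨(hM₂ n t ht x).1.trans (le_max_right _ _), (hM₂ n t ht x).2.1.trans (le_max_right _ _),
      (hM₂ n t ht x).2.2.trans (le_max_right _ _)⟩
  have h0T : (0 : ℝ) ∈ Set.Icc 0 T := ⟨le_rfl, hT.le⟩
  have hM0 : 0 ≤ M := (abs_nonneg _).trans (hMp (Classical.arbitrary _) 0 h0T 0).1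
  obtain ⟨L, hL0, hL⟩ := exists_lipschitz_nonlin hf hε M
  -- the difference of the two solutions, its derivatives and its current
  set w : Fin N → ℝ → ℝ → ℝ := fun n t x => p n t x - q n t x with hw
  set wt : Fin N → ℝ → ℝ → ℝ := fun n t x => dt T (p n) t x - dt T (q n) t x with hwt
  set wx : Fin N → ℝ → ℝ → ℝ := fun n t x => dx (p n) t x - dx (q n) t x with hwx
  set G : Fin N → ℝ → ℝ → ℝ := fun n t x =>
    (dx (flux ε f σ p n) t x + flux ε f σ p n t x)
      - (dx (flux ε f σ q n) t x + flux ε f σ q n t x) with hG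
  have w_init : ∀ n x, w n 0 x = 0 := fun n x => by
    simp only [hw, hps.init, hqs.init, sub_self]
  have w_contT : ∀ n x, ContinuousOn (fun s => w n s x) (Set.Icc 0 T) := fun n x t ht =>
    ((hp n).diff_t t ht x).continuousWithinAt.sub ((hq n).diff_t t ht x).continuousWithinAt
  have w_derivT : ∀ n, ∀ t ∈ Set.Ioo 0 T, ∀ x,
      HasDerivAt (fun s => w n s x) (wt n t x) t := fun n t ht x => by
    have ht' := Set.Ioo_subset_Icc_self ht
    have hn := Icc_mem_nhds ht.1 ht.2
    exact (((hp n).diff_t t ht' x).hasDerivWithinAt.hasDerivAt hn).fun_sub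
      (((hq n).diff_t t ht' x).hasDerivWithinAt.hasDerivAt hn)
  have w_derivX : ∀ n, ∀ t ∈ Set.Icc 0 T, ∀ x, HasDerivAt (w n t) (wx n t x) x :=
    fun n t ht x => ((hp n).diff_x t ht x).hasDerivAt.fun_sub ((hq n).diff_x t ht x).hasDerivAt
  have wt_cont : ∀ n, ∀ t ∈ Set.Icc 0 T, Continuous (wt n t) := fun n t ht =>
    ((hp n).cont_t.continuous ht).sub ((hq n).cont_t.continuous ht)
  have wx_cont : ∀ n, ∀ t ∈ Set.Icc 0 T, Continuous (wx n t) := fun n t ht =>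
    ((hp n).cont_x.continuous ht).sub ((hq n).cont_x.continuous ht)
  have w_bdd : ∀ n, ∀ t ∈ Set.Icc 0 T, ∀ x, |w n t x| ≤ M + M := fun n t ht x =>
    (abs_sub _ _).trans (add_le_add (hMp n t ht x).1 (hMq n t ht x).1)
  have wx_bdd : ∀ n, ∀ t ∈ Set.Icc 0 T, ∀ x, |wx n t x| ≤ M + M := fun n t ht x =>
    (abs_sub _ _).trans (add_le_add (hMp n t ht x).2.1 (hMq n t ht x).2.1)
  have wt_bdd : ∀ n, ∀ t ∈ Set.Icc 0 T, ∀ x, |wt n t x| ≤ M + M := fun n t ht x =>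
    (abs_sub _ _).trans (add_le_add (hMp n t ht x).2.2 (hMq n t ht x).2.2)
  have G_deriv : ∀ n, ∀ t ∈ Set.Icc 0 T, ∀ x, HasDerivAt (G n t) (2 * wt n t x) x :=
    fun n t ht x => ((hps.hasDerivAt_current hf hε hσ hp n ht x).fun_sub
      (hqs.hasDerivAt_current hf hε hσ hq n ht x)).congr_deriv (by simp only [hwt]; ring)
  -- The zero order coefficient of the current: `∂_x(σ²)` from differentiating the flux, plus `σ²`
  -- from the flux itself.
  set κ : ℝ → ℝ → ℝ := fun t x => 2 * σ t x * deriv (σ t) x + σ t x ^ 2 with hκ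
  set C := 2 * σ₁ * D + σ₁ ^ 2 with hC
  have σ_sq : ∀ t ∈ Set.Icc 0 T, ∀ x, σ₀ ^ 2 ≤ σ t x ^ 2 ∧ σ t x ^ 2 ≤ σ₁ ^ 2 :=
    fun t ht x => by
    obtain ⟨h1, h2⟩ := hσb t ht.1 x
    exact ⟨pow_le_pow_left₀ hσ₀.le h1 2, pow_le_pow_left₀ (hσ₀.le.trans h1) h2 2⟩
  have κ_le : ∀ t ∈ Set.Icc 0 T, ∀ x, |κ t x| ≤ C := fun t ht x => by
    obtain ⟨h1, h2⟩ := hσb t ht.1 x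
    have hs : 0 < σ t x := hσ₀.trans_le h1
    refine (abs_add_le _ _).trans (add_le_add ?_ ?_)
    · rw [abs_mul, abs_of_pos (by positivity)]
      exact mul_le_mul (by linarith) (hD t ht.1 x) (abs_nonneg _) (by linarith)
    · rw [abs_of_pos (by positivity)]
      exact (σ_sq t ht x).2
  have hC0 : 0 ≤ C := (abs_nonneg _).trans (κ_le 0 h0T 0)
  have G_eq : ∀ n, ∀ t ∈ Set.Icc 0 T, ∀ x, G n t x =
      κ t x * (nonlin ε f n (fun k => p k t x) - nonlin ε f n fun k => q k t x)
        + σ t x ^ 2 * (nonlinDeriv ε f n (fun k => p k t x) (fun k => dx (p k) t x)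
          - nonlinDeriv ε f n (fun k => q k t x) fun k => dx (q k) t x) := fun n t ht x => by
    simp only [hG, hκ]
    rw [(dx_flux_eq hf hε hσ hp ht (fun n x => hps.nonneg n t ht x) n x).2,
      (dx_flux_eq hf hε hσ hq ht (fun n x => hqs.nonneg n t ht x) n x).2]
    simp only [flux, nonlin]
    ring
  have dp_ne : ∀ t ∈ Set.Icc 0 T, ∀ x, ε + ∑ k, f k * p k t x ≠ 0 := fun t ht x =>
    (hε.trans_le (denom_ge hf fun k => hps.nonneg k t ht x)).ne'
  have dq_ne : ∀ t ∈ Set.Icc 0 T, ∀ x, ε + ∑ k, f k * q k t x ≠ 0 := fun t ht x =>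
    (hε.trans_le (denom_ge hf fun k => hqs.nonneg k t ht x)).ne'
  -- the sums over `n` solve the same linear equation
  have sum_G : ∀ t ∈ Set.Icc 0 T, ∀ x,
      ∑ n, G n t x = κ t x * ∑ n, w n t x + σ t x ^ 2 * ∑ n, wx n t x := fun t ht x => by
    simp only [G_eq _ t ht x, Finset.sum_add_distrib, ← Finset.mul_sum, Finset.sum_sub_distrib,
      sum_nonlin (dp_ne t ht x), sum_nonlin (dq_ne t ht x), sum_nonlinDeriv (dp_ne t ht x),
      sum_nonlinDeriv (dq_ne t ht x), hw, hwx]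
  have abs_sum_le : ∀ {g : Fin N → ℝ}, (∀ i, |g i| ≤ M + M) →
      |∑ i, g i| ≤ ∑ _i : Fin N, (M + M) :=
    fun h => (Finset.abs_sum_le_sum_abs _ _).trans (Finset.sum_le_sum fun i _ => h i)
  -- The energy method for a single unknown; coercivity here is just `σ² ≥ σ₀²`.
  have sum_w : ∀ t ∈ Set.Icc 0 T, ∀ x, ∑ n, w n t x = 0 := fun t ht x =>
    eq_zero_of_coercive (ι := Unit) (T := T) (c := σ₀ ^ 2) (C := C + σ₁ ^ 2)
      (M := ∑ _i : Fin N, (M + M)) hT (by positivity) (by positivity)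
      (w := fun _ t x => ∑ n, w n t x) (wt := fun _ t x => ∑ n, wt n t x)
      (wx := fun _ t x => ∑ n, wx n t x) (G := fun _ t x => ∑ n, G n t x)
      (fun _ x => Finset.sum_eq_zero fun n _ => w_init n x)
      (fun _ x => continuousOn_finsetSum _ fun n _ => w_contT n x)
      (fun _ t ht x => HasDerivAt.fun_sum fun n _ => w_derivT n t ht x)
      (fun _ t ht x => HasDerivAt.fun_sum fun n _ => w_derivX n t ht x)
      (fun _ t ht => continuous_finsetSum _ fun n _ => wt_cont n t ht)
      (fun _ t ht => continuous_finsetSum _ fun n _ => wx_cont n t ht)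
      (fun _ t ht x => abs_sum_le fun n => w_bdd n t ht x)
      (fun _ t ht x => abs_sum_le fun n => wt_bdd n t ht x)
      (fun _ t ht x => abs_sum_le fun n => wx_bdd n t ht x)
      (fun _ t ht x => (HasDerivAt.fun_sum fun n _ => G_deriv n t ht x).congr_deriv
        (Finset.mul_sum _ _ _).symm)
      (fun _ t ht x => by
        simp only [Finset.univ_unique, Finset.sum_singleton]
        rw [sum_G t ht x]
        refine (abs_add_le _ _).trans ?_
        rw [abs_mul, abs_mul, abs_of_nonneg (sq_nonneg (σ t x))]
        have h1 := mul_le_mul_of_nonneg_right (κ_le t ht x) (abs_nonneg (∑ n, w n t x))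
        have h2 := mul_le_mul_of_nonneg_right (σ_sq t ht x).2 (abs_nonneg (∑ n, wx n t x))
        have h3 := mul_nonneg hC0 (abs_nonneg (∑ n, wx n t x))
        have h4 := mul_nonneg (sq_nonneg σ₁) (abs_nonneg (∑ n, w n t x))
        linarith)
      (fun t ht x => by
        simp only [Finset.univ_unique, Finset.sum_singleton]
        rw [sum_G t ht x]
        set W := ∑ n, w n t x
        set X := ∑ n, wx n t x
        have h1 := mul_le_mul_of_nonneg_right (σ_sq t ht x).1 (sq_nonneg X)
        have h2 : |κ t x * (W * X)| ≤ C * (|W| * |X|) := by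
          rw [abs_mul, abs_mul]
          exact mul_le_mul_of_nonneg_right (κ_le t ht x) (by positivity)
        have h3 := neg_abs_le (κ t x * (W * X))
        have h4 : 0 ≤ σ₁ ^ 2 * (|W| * |X|) := by positivity
        linarith)
      () t ht x
  have sum_wx : ∀ t ∈ Set.Icc 0 T, ∀ x, ∑ n, wx n t x = 0 := fun t ht x => by
    have h1 : HasDerivAt (fun y => ∑ n, w n t y) (∑ n, wx n t x) x :=
      HasDerivAt.fun_sum fun n _ => w_derivX n t ht x
    rw [funext (sum_w t ht)] at h1
    exact h1.unique (hasDerivAt_const x 0)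
  intro n t ht x
  -- The constant `c` bounds `σ² ε² / (ε + ∑ f_k p_k)²` from below, using `p_k ≤ M`.
  refine sub_eq_zero.1 (eq_zero_of_coercive (T := T)
    (c := σ₀ ^ 2 * (ε ^ 2 / (ε + ∑ k, f k * M) ^ 2)) (C := (C + σ₁ ^ 2) * L) (M := M + M) hT
    ?_ (by positivity) w_init w_contT w_derivT w_derivX wt_cont wx_cont w_bdd wt_bdd wx_bdd
    G_deriv ?_ ?_ n t ht x)
  · have : 0 ≤ ∑ k, f k * M := Finset.sum_nonneg fun k _ => mul_nonneg (hf k).le hM0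
    positivity
  · intro n t ht x
    obtain ⟨l1, l2⟩ := hL (fun k => p k t x) (fun k => q k t x) (fun k => dx (p k) t x)
      (fun k => dx (q k) t x) (fun k => hps.nonneg k t ht x) (fun k => hqs.nonneg k t ht x)
      (fun k => (hMp k t ht x).1) (fun k => (hMq k t ht x).1) (fun k => (hMp k t ht x).2.1)
      (fun k => (hMq k t ht x).2.1) n
    rw [G_eq n t ht x]
    refine (abs_add_le _ _).trans ?_
    rw [abs_mul, abs_mul, abs_of_nonneg (sq_nonneg (σ t x))]
    have h1 := mul_le_mul (κ_le t ht x) l1 (abs_nonneg _) hC0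
    have h2 := mul_le_mul (σ_sq t ht x).2 l2 (abs_nonneg _) (sq_nonneg _)
    have h3 : 0 ≤ C * L * ∑ i, |wx i t x| :=
      mul_nonneg (by positivity) (Finset.sum_nonneg fun _ _ => abs_nonneg _)
    simp only [hw, hwx] at h3 ⊢
    linarith
  · intro t ht x
    set A := ∑ i, |w i t x| with hA
    have hA0 : 0 ≤ A := Finset.sum_nonneg fun _ _ => abs_nonneg _
    -- the part of the current that is not of leading order
    set R : Fin N → ℝ := fun n => G n t x
      - σ t x ^ 2 * nonlinDeriv ε f n (fun k => p k t x) (fun k => wx k t x) with hR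
    -- Linearity of `nonlinDeriv` in its last argument leaves a difference of Jacobians at `p` and
    -- `q`, both applied to `∂_x q`. So `R` is controlled by `w` alone, and its pairing with `∂_x w`
    -- is an admissible cross term.
    have hRle : ∀ n, |R n| ≤ (C + σ₁ ^ 2) * L * A := fun n => by
      obtain ⟨l1, l2⟩ := hL (fun k => p k t x) (fun k => q k t x) (fun k => dx (q k) t x)
        (fun k => dx (q k) t x) (fun k => hps.nonneg k t ht x) (fun k => hqs.nonneg k t ht x)
        (fun k => (hMp k t ht x).1) (fun k => (hMq k t ht x).1) (fun k => (hMq k t ht x).2.1)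
        (fun k => (hMq k t ht x).2.1) n
      simp only [sub_self, abs_zero, Finset.sum_const_zero, add_zero] at l2
      have e : R n = κ t x * (nonlin ε f n (fun k => p k t x) - nonlin ε f n fun k => q k t x)
          + σ t x ^ 2 * (nonlinDeriv ε f n (fun k => p k t x) (fun k => dx (q k) t x)
            - nonlinDeriv ε f n (fun k => q k t x) fun k => dx (q k) t x) := by
        simp only [hR, hwx]
        rw [G_eq n t ht x, ← nonlinDeriv_sub]
        ring
      rw [e]
      refine (abs_add_le _ _).trans ?_
      rw [abs_mul, abs_mul, abs_of_nonneg (sq_nonneg (σ t x))]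
      have h1 := mul_le_mul (κ_le t ht x) l1 (abs_nonneg _) hC0
      have h2 := mul_le_mul (σ_sq t ht x).2 l2 (abs_nonneg _) (sq_nonneg _)
      simp only [hA, hw]
      linarith
    have hsum : ∑ i, wx i t x * G i t x = σ t x ^ 2 * ∑ i, wx i t x *
        nonlinDeriv ε f i (fun k => p k t x) (fun k => wx k t x) + ∑ i, wx i t x * R i := by
      rw [Finset.mul_sum, ← Finset.sum_add_distrib]
      exact Finset.sum_congr rfl fun i _ => by simp only [hR]; ring
    have hRsum : |∑ i, wx i t x * R i| ≤ (C + σ₁ ^ 2) * L * A * ∑ i, |wx i t x| := by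
      refine (Finset.abs_sum_le_sum_abs _ _).trans ?_
      rw [Finset.mul_sum]
      refine Finset.sum_le_sum fun i _ => ?_
      rw [abs_mul, mul_comm]
      exact mul_le_mul_of_nonneg_right (hRle i) (abs_nonneg _)
    have hcoer := sum_mul_nonlinDeriv_ge hN hf hcond hε
      (fun k => hps.nonneg k t ht x) (sum_wx t ht x)
    have hden : ε ^ 2 / (ε + ∑ k, f k * M) ^ 2 ≤ ε ^ 2 / (ε + ∑ k, f k * p k t x) ^ 2 := by
      have hpos : 0 < ε + ∑ k, f k * p k t x :=
        hε.trans_le (denom_ge hf fun k => hps.nonneg k t ht x)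
      gcongr with k
      · exact (hf k).le
      · exact (abs_le.1 (hMp k t ht x).1).2
    have hwx2 : 0 ≤ ∑ i, wx i t x ^ 2 := Finset.sum_nonneg fun _ _ => sq_nonneg _
    have h1 := (mul_le_mul_of_nonneg_right hden hwx2).trans hcoer
    have h2 := mul_le_mul (σ_sq t ht x).1 h1 (by positivity) (sq_nonneg _)
    rw [hsum]
    linarith [neg_abs_le (∑ i, wx i t x * R i)]
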